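/- Let $X$ be a compact metric space with metric $\rho$ and let $T\colon X\to X$ be a continuous surjective map. Assume that $(X,T)$ has the shadowing property: for every $\varepsilon>0$ there is $\delta>0$ such that for every sequence $(x_n)_{n\ge 0}$ in $X$ with $\rho(T(x_n),x_{n+1})<\delta$ for all $n\ge 0$ there is $y\in X$ with $\rho(x_n,T^n(y))<\varepsilon$ for all $n\ge 0$. Then the following conditions are equivalent: 1. $T$ is transitive, that is, for all non-empty open sets $U,V\subset X$ there is an integer $n>0$ with $U\cap T^{-n}(V)\neq\emptyset$; 2. $(X,T)$ has the approximate product property of Pfister and Sullivan, that is, for all $\varepsilon,\delta_1,\delta_2>0$ there is an integer $N>0$ such that for every $n\ge N$ and every sequence $(x_i)_{i\ge 1}$ in $X$ there are integers $h_i\ge 0$ $(i\ge 1)$ and a point $y\in X$ with $h_1=0$ and, for all $i\ge 1$, $n\le h_{i+1}-h_i\le n(1+\delta_2)$ and $$\bigl|\{0\le j<n : \rho(T^{h_i+j}(y),T^j(x_i))>\varepsilon\}\bigr|\le \delta_1 n .$$ -/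

import Mathlib

namespace TopDyn

/-- `T` is transitive: for all non-empty open sets `U`, `V` there is `n > 0` with
`U ∩ T⁻ⁿ(V) ≠ ∅`. -/
def IsTransitive {X : Type*} [TopologicalSpace X] (T : X → X) : Prop :=
  ∀ U V : Set X, IsOpen U → U.Nonempty → IsOpen V → V.Nonempty →
    ∃ n : ℕ, 0 < n ∧ (U ∩ (T^[n]) ⁻¹' V).Nonempty

/-- The sequence `x` is a `δ`-pseudo-orbit for `T`. -/
def IsPseudoOrbit {X : Type*} [MetricSpace X] (T : X → X) (δ : ℝ) (x : ℕ → X) : Prop :=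
  ∀ n : ℕ, dist (T (x n)) (x (n + 1)) < δ

/-- The shadowing (pseudo-orbit tracing) property. -/
def HasShadowing {X : Type*} [MetricSpace X] (T : X → X) : Prop :=
  ∀ ε : ℝ, 0 < ε → ∃ δ : ℝ, 0 < δ ∧
    ∀ x : ℕ → X, IsPseudoOrbit T δ x → ∃ y : X, ∀ n : ℕ, dist (x n) (T^[n] y) < ε

/-- The approximate product property (approximate product structure). Sequences are indexed
from `0` here, so the normalisation of the starting times reads `h 0 = 0`. -/
def HasApproximateProduct {X : Type*} [MetricSpace X] (T : X → X) : Prop :=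
  ∀ ε δ₁ δ₂ : ℝ, 0 < ε → 0 < δ₁ → 0 < δ₂ →
    ∃ N : ℕ, 0 < N ∧ ∀ n : ℕ, N ≤ n → ∀ x : ℕ → X,
      ∃ (h : ℕ → ℕ) (y : X), h 0 = 0 ∧
        (∀ i : ℕ, (n : ℝ) ≤ (h (i + 1) : ℝ) - (h i : ℝ) ∧
          (h (i + 1) : ℝ) - (h i : ℝ) ≤ (n : ℝ) * (1 + δ₂)) ∧
        ∀ i : ℕ, (({j : ℕ | j < n ∧ ε < dist (T^[h i + j] y) (T^[j] (x i))}.ncard : ℕ) : ℝ)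
          ≤ δ₁ * (n : ℝ)

end TopDyn

/-!
A `δ`-chain is a finite path for the relation `dist (T a) b < δ`.

Transitivity and compactness give a bound `M`, depending only on `δ`, such that any point can be
joined to any other by a `δ`-chain through at most `M` intermediate points
(`IsTransitive.exists_uniform_transit`). The orbit segments of length `n` of the given points can
therefore be joined into one `δ`-pseudo-orbit with gaps of length at most `M ≤ n δ₂` once `n` is
large (`exists_isPseudoOrbit_concat`). A point shadowing it follows every segment without any
error.

Conversely, shadowing reduces transitivity to the existence of `δ`-chains between any two points
(`isTransitive_of_chains`). Apply the approximate product property with `δ₁ = 1/2` to `T u` and to a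
preimage `v'` of `v` under `T^n`. The resulting orbit passes close to both segments at least once,
so it provides a chain from the orbit of `u` to some `T^j v'` with `j < n`, and from there the orbit
of `v'` leads to `v`. Surjectivity is what makes `v'` available.
-/

namespace TopDyn

variable {X : Type*} [MetricSpace X] {T : X → X} {δ : ℝ}

/-! ### Chains and pseudo-orbits -/

/-- One step of a `δ`-chain: `b` is `δ`-close to the image of `a`. -/
def ChainStep (T : X → X) (δ : ℝ) (a b : X) : Prop :=
  dist (T a) b < δ

theorem reflTransGen_chainStep_iterate (hδ : 0 < δ) (a : X) (k : ℕ) :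
    Relation.ReflTransGen (ChainStep T δ) a (T^[k] a) := by
  induction k with
  | zero => exact .refl
  | succ k ih =>
    refine ih.tail ?_
    rw [Function.iterate_succ_apply']
    simpa [ChainStep] using hδ

/-- A `δ`-chain of positive length extends to a `δ`-pseudo-orbit, which continues along the true
orbit of the last point of the chain. -/
theorem exists_isPseudoOrbit_of_transGen (hδ : 0 < δ) {u v : X}
    (h : Relation.TransGen (ChainStep T δ) u v) :
    ∃ p : ℕ → X, IsPseudoOrbit T δ p ∧ p 0 = u ∧ ∃ n, 0 < n ∧ p n = v := by
  induction h using Relation.TransGen.head_induction_on with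
  | @single a h =>
    refine ⟨fun k => Nat.casesOn k a fun k => T^[k] v, ?_, rfl, 1, one_pos, rfl⟩
    rintro (_ | k)
    · exact h
    · simpa [← Function.iterate_succ_apply' T] using hδ
  | @head a c h _ ih =>
    obtain ⟨p, hp, rfl, n, -, hn⟩ := ih
    refine ⟨fun k => Nat.casesOn k a p, ?_, rfl, n + 1, n.succ_pos, hn⟩
    rintro (_ | k)
    · exact h
    · exact hp k

theorem isTransitive_of_chains (hshadow : HasShadowing T)
    (h : ∀ δ : ℝ, 0 < δ → ∀ u v : X, Relation.TransGen (ChainStep T δ) u v) :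
    IsTransitive T := by
  rintro U V hU ⟨u, hu⟩ hV ⟨v, hv⟩
  obtain ⟨ε₁, hε₁, hU⟩ := Metric.isOpen_iff.1 hU u hu
  obtain ⟨ε₂, hε₂, hV⟩ := Metric.isOpen_iff.1 hV v hv
  obtain ⟨δ, hδ, hs⟩ := hshadow (min ε₁ ε₂) (lt_min hε₁ hε₂)
  obtain ⟨p, hp, rfl, n, hn, rfl⟩ := exists_isPseudoOrbit_of_transGen hδ (h δ hδ u v)
  obtain ⟨y, hy⟩ := hs p hp
  refine ⟨n, hn, y, hU ?_, hV ?_⟩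
  · exact Metric.mem_ball'.2 ((hy 0).trans_le (min_le_left _ _))
  · exact Metric.mem_ball'.2 ((hy n).trans_le (min_le_right _ _))

/-! ### From approximate products to transitivity -/

theorem exists_lt_dist_le_of_ncard_le {n : ℕ} (hn : 0 < n) {ε : ℝ} {a b : ℕ → X}
    (h : (({j : ℕ | j < n ∧ ε < dist (a j) (b j)}.ncard : ℕ) : ℝ) ≤ 1 / 2 * (n : ℝ)) :
    ∃ j < n, dist (a j) (b j) ≤ ε := by
  by_contra! hc
  have hset : {j : ℕ | j < n ∧ ε < dist (a j) (b j)} = (Finset.range n : Set ℕ) := by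
    ext j
    simpa using hc j
  rw [hset, Set.ncard_coe_finset, Finset.card_range] at h
  have : (0 : ℝ) < n := by exact_mod_cast hn
  linarith

theorem HasApproximateProduct.transGen_chainStep (happ : HasApproximateProduct T)
    (hsurj : Function.Surjective T) (hδ : 0 < δ) (u v : X) :
    Relation.TransGen (ChainStep T δ) u v := by
  obtain ⟨n, hn, H⟩ := happ (δ / 2) (1 / 2) 1 (half_pos hδ) one_half_pos one_pos
  obtain ⟨v', rfl⟩ := hsurj.iterate n v
  -- The first segment starts at `T u`, so that the jump to the orbit of `y` can be made from
  -- `T^[j] u` even when `j = 0`.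
  obtain ⟨h, y, h0, hh, hcard⟩ := H n le_rfl fun i => if i = 0 then T u else v'
  obtain ⟨j, hj, hju⟩ := exists_lt_dist_le_of_ncard_le hn (hcard 0)
  obtain ⟨k, hk, hkv⟩ := exists_lt_dist_le_of_ncard_le hn (hcard 1)
  simp only [h0, zero_add, if_true, one_ne_zero, if_false] at hju hkv
  have h1 : n ≤ h 1 := by
    have := (hh 0).1
    rw [h0] at this
    simpa using this
  -- The jump to the orbit of `v'` is made from `T^[h 1 + k - 1] y`, that is `T^[m + j] y`.
  obtain ⟨m, hm⟩ : ∃ m, h 1 + k = m + j + 1 := ⟨h 1 + k - j - 1, by omega⟩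
  have s1 : ChainStep T δ (T^[j] u) (T^[j] y) := by
    rw [ChainStep, ← Function.iterate_succ_apply' T, Function.iterate_succ_apply, dist_comm]
    linarith
  have s2 : ChainStep T δ (T^[m] (T^[j] y)) (T^[k] v') := by
    rw [ChainStep, ← Function.iterate_add_apply, ← Function.iterate_succ_apply' T,
      Nat.succ_eq_add_one, ← hm]
    linarith
  have s3 := reflTransGen_chainStep_iterate (T := T) hδ (T^[k] v') (n - k)
  rw [← Function.iterate_add_apply, Nat.sub_add_cancel hk.le] at s3
  exact ((Relation.TransGen.tail' (reflTransGen_chainStep_iterate hδ u j) s1).trans_left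
    (reflTransGen_chainStep_iterate hδ _ m)).tail s2 |>.trans_left s3

/-! ### From transitivity to approximate products -/

/-- On a compact space the transit times provided by transitivity are uniformly bounded at each
scale `δ`. -/
theorem IsTransitive.exists_uniform_transit [CompactSpace X] (htrans : IsTransitive T)
    (hδ : 0 < δ) :
    ∃ M : ℕ, ∀ a b : X, ∃ k z, 0 < k ∧ k ≤ M ∧ dist a z < δ ∧ dist (T^[k] z) b < δ := by
  obtain ⟨t, -, ht, hcover⟩ :=
    finite_cover_balls_of_compact (isCompact_univ (X := X)) (half_pos hδ)
  have key : ∀ c d : X, ∃ k, 0 < k ∧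
      (Metric.ball c (δ / 2) ∩ (T^[k]) ⁻¹' Metric.ball d (δ / 2)).Nonempty := fun c d =>
    htrans _ _ Metric.isOpen_ball (Metric.nonempty_ball.2 (half_pos hδ))
      Metric.isOpen_ball (Metric.nonempty_ball.2 (half_pos hδ))
  choose k hk hz using key
  obtain ⟨M, hM⟩ := ((ht.prod ht).image fun q => k q.1 q.2).bddAbove
  refine ⟨M, fun a b => ?_⟩
  obtain ⟨c, hc, hac⟩ : ∃ c ∈ t, dist a c < δ / 2 := by simpa using hcover (Set.mem_univ a)
  obtain ⟨d, hd, hbd⟩ : ∃ d ∈ t, dist b d < δ / 2 := by simpa using hcover (Set.mem_univ b)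
  obtain ⟨z, hzc, hzd⟩ := hz c d
  rw [Metric.mem_ball] at hzc
  rw [Set.mem_preimage, Metric.mem_ball] at hzd
  refine ⟨k c d, z, hk c d, hM ⟨(c, d), ⟨hc, hd⟩, rfl⟩, ?_, ?_⟩
  · linarith [dist_triangle_right a z c]
  · linarith [dist_triangle_right (T^[k c d] z) b d]

/-- The position reached after `m` steps when blocks of lengths `L 0, L 1, …` are read one after
the other: the index of the current block and the offset within it. -/
def blockPosition (L : ℕ → ℕ) : ℕ → ℕ × ℕ
  | 0 => (0, 0)
  | m + 1 =>
    if (blockPosition L m).2 + 1 < L (blockPosition L m).1 then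
      ((blockPosition L m).1, (blockPosition L m).2 + 1)
    else ((blockPosition L m).1 + 1, 0)

theorem blockPosition_snd_lt {L : ℕ → ℕ} (hL : ∀ i, 0 < L i) (m : ℕ) :
    (blockPosition L m).2 < L (blockPosition L m).1 := by
  induction m with
  | zero => exact hL 0
  | succ m ih =>
    rw [blockPosition]
    split_ifs with h
    · exact h
    · exact hL _

theorem blockPosition_sum_add {L : ℕ → ℕ} (hL : ∀ i, 0 < L i) (i j : ℕ) (hj : j < L i) :
    blockPosition L (∑ l ∈ Finset.range i, L l + j) = (i, j) := by
  induction i generalizing j with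
  | zero =>
    induction j with
    | zero => rfl
    | succ j ih =>
      rw [← add_assoc, blockPosition, ih (by omega), if_pos hj]
  | succ i ihi =>
    induction j with
    | zero =>
      have hs : ∑ l ∈ Finset.range (i + 1), L l + 0
          = (∑ l ∈ Finset.range i, L l + (L i - 1)) + 1 := by
        have := hL i
        rw [Finset.sum_range_succ]
        omega
      have := hL i
      rw [hs, blockPosition, ihi _ (by omega), if_neg (by simp only; omega)]
    | succ j ih =>
      rw [← add_assoc, blockPosition, ih (by omega), if_pos hj]

/-- Blocks `w i 0, …, w i (L i - 1)` of pseudo-orbit whose consecutive ends match can be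
concatenated into one pseudo-orbit. -/
theorem exists_isPseudoOrbit_concat {L : ℕ → ℕ} (hL : ∀ i, 0 < L i) {w : ℕ → ℕ → X}
    (hw : ∀ i j, j + 1 < L i → dist (T (w i j)) (w i (j + 1)) < δ)
    (hjoin : ∀ i j, j + 1 = L i → dist (T (w i j)) (w (i + 1) 0) < δ) :
    ∃ p : ℕ → X, IsPseudoOrbit T δ p ∧
      ∀ i j, j < L i → p (∑ l ∈ Finset.range i, L l + j) = w i j := by
  refine ⟨fun m => w (blockPosition L m).1 (blockPosition L m).2, fun m => ?_, fun i j hj => ?_⟩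
  · have hlt := blockPosition_snd_lt hL m
    simp only [blockPosition]
    split_ifs with h
    · exact hw _ _ h
    · exact hjoin _ _ (by omega)
  · simp only [blockPosition_sum_add hL i j hj]

theorem IsTransitive.hasApproximateProduct [CompactSpace X] (htrans : IsTransitive T)
    (hshadow : HasShadowing T) : HasApproximateProduct T := by
  intro ε δ₁ δ₂ hε hδ₁ hδ₂
  obtain ⟨δ, hδ, hs⟩ := hshadow ε hε
  obtain ⟨M, hM⟩ := htrans.exists_uniform_transit hδ
  obtain ⟨N, hN⟩ := exists_nat_ge ((M : ℝ) / δ₂)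
  refine ⟨N + 1, N.succ_pos, fun n hn x => ?_⟩
  have hMn : (M : ℝ) ≤ n * δ₂ := by
    rw [← div_le_iff₀ hδ₂]
    exact hN.trans (by exact_mod_cast (Nat.le_succ N).trans hn)
  choose k z hk hkM hz hzx using fun i => hM (T^[n] (x i)) (x (i + 1))
  let w : ℕ → ℕ → X := fun i j => if j < n then T^[j] (x i) else T^[j - n] (z i)
  obtain ⟨p, hp, hpw⟩ : ∃ p : ℕ → X, IsPseudoOrbit T δ p ∧
      ∀ i j, j < n + k i → p (∑ l ∈ Finset.range i, (n + k l) + j) = w i j := by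
    refine exists_isPseudoOrbit_concat (L := fun i => n + k i) (fun i => by omega) ?_ ?_
    · intro i j _
      rcases lt_trichotomy (j + 1) n with h | rfl | h
      · simpa only [w, if_pos h, if_pos (Nat.lt_of_succ_lt h), ← Function.iterate_succ_apply' T,
          dist_self, Nat.succ_eq_add_one] using hδ
      · simpa only [w, if_pos j.lt_succ_self, lt_irrefl, if_false, Nat.sub_self,
          ← Function.iterate_succ_apply' T, Nat.succ_eq_add_one, Function.iterate_zero_apply]
          using hz i
      · have hj : j + 1 - n = (j - n) + 1 := by omega
        simpa only [w, if_neg h.not_gt, if_neg (Nat.le_of_lt_succ h).not_gt, hj,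
          ← Function.iterate_succ_apply' T, dist_self, Nat.succ_eq_add_one] using hδ
    · intro i j hj
      have hki := hk i
      have hj' : (j - n).succ = k i := by omega
      have hnj : ¬ j < n := by omega
      have hn0 : 0 < n := by omega
      simpa only [w, if_neg hnj, if_pos hn0, ← Function.iterate_succ_apply' T, hj',
        Function.iterate_zero_apply] using hzx i
  obtain ⟨y, hy⟩ := hs p hp
  refine ⟨fun i => ∑ l ∈ Finset.range i, (n + k l), y, rfl, fun i => ?_, fun i => ?_⟩
  · have hki : (k i : ℝ) ≤ M := by exact_mod_cast hkM i
    have hk0 : (0 : ℝ) ≤ k i := Nat.cast_nonneg _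
    simp only [Finset.sum_range_succ]
    push_cast
    constructor <;> linarith
  · have hempty : {j : ℕ | j < n ∧
        ε < dist (T^[∑ l ∈ Finset.range i, (n + k l) + j] y) (T^[j] (x i))} = ∅ := by
      refine Set.eq_empty_of_forall_notMem fun j hj => ?_
      have hyj := hy (∑ l ∈ Finset.range i, (n + k l) + j)
      rw [hpw i j (by have := hj.1; omega), dist_comm] at hyj
      simp only [w, if_pos hj.1] at hyj
      exact lt_asymm hj.2 hyj
    rw [hempty, Set.ncard_empty, Nat.cast_zero]
    positivity

end TopDyn

theorem mainTheorem1 {X : Type*} [MetricSpace X] [CompactSpace X] (T : X → X)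
    (hcont : Continuous T) (hsurj : Function.Surjective T)
    (hshadow : TopDyn.HasShadowing T) :
    TopDyn.IsTransitive T ↔ TopDyn.HasApproximateProduct T :=
  ⟨fun h => h.hasApproximateProduct hshadow, fun h =>
    TopDyn.isTransitive_of_chains hshadow fun _ hδ u v => h.transGen_chainStep hsurj hδ u v⟩
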